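/- **Setting.** Let $(\Omega,\mathbf P)$ be a probability space, let the action set $\mathcal A$, the outcome space $\mathcal Y$ and the space $\Xi$ be (nonempty) standard Borel spaces, and let $R:\mathcal Y\to\mathbb R$ be a measurable reward function. For each time $t\in\{0,1,2,\dots\}\cup\{\infty\}$ let $Y_t=(Y_{t,a})_{a\in\mathcal A}$ be a vector of $\mathcal Y$-valued random outcomes, with $(\omega,a)\mapsto Y_{t,a}(\omega)$ measurable. There is a random variable $\theta$ such that, conditioned on $\theta$, the vectors $Y_0,Y_1,Y_2,\dots,Y_\infty$ are i.i.d. with law $\kappa_\theta$, where $\kappa$ is a Markov kernel. Let $\xi$ be a $\Xi$-valued random variable that is independent of $(\theta,(Y_t)_{t\in\mathbb N_0})$. An action process is a sequence of $\mathcal A$-valued random variables of the form $A_t=\pi_t(\mathcal F_t,\xi)$, $t\in\mathbb N_0$, where $\mathcal F_t=(A_0,Y_{0,A_0},\dots,A_{t-1},Y_{t-1,A_{t-1}})$ is the history and the $\pi_t$ are measurable functions. Write $R_{t,A_t}=R(Y_{t,A_t})$ and $\mathbf E_t[\cdot]=\mathbf E[\cdot\mid\mathcal F_t]$. Let $R^*=\sup_{a\in\mathcal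 A}\mathbf E[R(Y_{\infty,a})\mid\theta]$, where the conditional means are computed with $\kappa_\theta$. For a random action $\tilde A:\Omega\to\mathcal A$ let $\tilde R=R(Y_{\infty,\tilde A})$. Let $\mathbf I_t(\tilde A;Y_{t,A_t}\mid\xi)\in[0,\infty]$ be the conditional mutual information of $\tilde A$ and $Y_{t,A_t}$ given $\xi$, computed under the conditional law of $(\tilde A,Y_{t,A_t},\xi)$ given $\mathcal F_t$ (a random variable, as it depends on the realized history), and let $\mathbf H(\tilde A\mid\xi)\in[0,\infty]$ be the conditional Shannon entropy, i.e. the expectation of the entropy of the conditional law of $\tilde A$ given $\xi$ (the entropy of a non-discrete law being $\infty$). For a discount factor $\alpha\in[0,1)$ define the discounted information ratio $$\Gamma\bigl(\tilde A,\{A_t\}\bigr)=(1-\alpha^2)\sum_{t=0}^\infty\alpha^{2t}\,\mathbf E\left[\frac{\bigl(\mathbf E_t[\tilde R-R_{t,A_t}]\bigr)^2}{\mathbf I_t(\tilde A;Y_{t,A_t}\mid\xi)}\right]\in[0,\infty],$$ with the conventions $0/0=0$, $c/0=\infty$ for $c>0$, $c/\infty=0$, and $0\cdot\infty=0$ for the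 products $\alpha^{2t}\cdot\mathbf E[\cdot]$. **Theorem.** Let $\alpha\in[0,1)$, let $\{A_t:t\in\mathbb N_0\}$ be an action process and let $\tilde A:\Omega\to\mathcal A$ be a random action. Suppose that almost surely the means $\mathbf E[R(Y_{\infty,a})\mid\theta]$, $a\in\mathcal A$, exist and are bounded above in $a$, that $R^*$, $\tilde R$ and every $R_{t,A_t}$ are integrable, and that $\sum_{t}\alpha^t\,\mathbf E|R_{t,A_t}|<\infty$ (all this holds, for instance, if $R$ is bounded and $R^*$ is measurable). Suppose also that the product $\Gamma(\tilde A,\{A_t\})\cdot\mathbf H(\tilde A\mid\xi)$ is not of the undefined form $0\cdot\infty$ or $\infty\cdot 0$. Then $$\mathbf E\left[\sum_{t=0}^\infty\alpha^t\,(R^*-R_{t,A_t})\right]\le\frac{\mathbf E[R^*-\tilde R]}{1-\alpha}+\sqrt{\frac{\Gamma\bigl(\tilde A,\{A_t\}\bigr)\,\mathbf H(\tilde A\mid\xi)}{1-\alpha^2}},$$ where the right-hand side may be $+\infty$. -/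

import Mathlib

open MeasureTheory ProbabilityTheory InformationTheory
open scoped ENNReal

/-- Shannon entropy (in nats) of a probability measure: the expectation of `-log μ{x}`.
It is `∑ x, -μ{x} log μ{x}` for a discrete `μ` and `∞` for a measure that is not discrete. -/
noncomputable def shannonEntropy {E : Type*} [MeasurableSpace E] (μ : Measure E) : ℝ≥0∞ :=
  ∫⁻ x, (-ENNReal.log (μ {x})).toENNReal ∂μ

/-- On a countable space the entropy is the usual sum `-∑ x, μ{x} log μ{x}`. -/
theorem shannonEntropy_eq_tsum {E : Type*} [MeasurableSpace E] [Countable E]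
    [MeasurableSingletonClass E] (μ : Measure E) [IsProbabilityMeasure μ] :
    shannonEntropy μ = ∑' x, ENNReal.ofReal (Real.negMulLog (μ.real {x})) := by
  rw [shannonEntropy, lintegral_countable']
  refine tsum_congr fun x => ?_
  rcases eq_or_ne (μ {x}) 0 with h | h
  · simp [h, measureReal_def]
  · have hlog : ENNReal.log (μ {x}) = ((Real.log (μ.real {x}) : ℝ) : EReal) :=
      ENNReal.log_pos_real h (measure_ne_top μ _)
    have hle : (0 : ℝ) ≤ -Real.log (μ.real {x}) := by
      have := Real.log_nonpos (measureReal_nonneg (μ := μ) (s := {x})) measureReal_le_one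
      linarith
    have hneg : Real.negMulLog (μ.real {x}) = -Real.log (μ.real {x}) * μ.real {x} := by
      rw [Real.negMulLog]; ring
    rw [hlog, hneg, ENNReal.ofReal_mul hle, ← EReal.coe_neg, EReal.toENNReal_of_ne_top (by simp)]
    simp

/-- Conditional entropy `H(X | Z)`: the expected entropy of the conditional law of `X` given `Z`. -/
noncomputable def condEntropy {Ω E G : Type*} [MeasurableSpace Ω]
    [MeasurableSpace E] [StandardBorelSpace E] [Nonempty E] [MeasurableSpace G]
    (X : Ω → E) (Z : Ω → G) (μ : Measure Ω) [IsFiniteMeasure μ] : ℝ≥0∞ :=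
  ∫⁻ ω, shannonEntropy (condDistrib X Z μ (Z ω)) ∂μ

/-- Conditional mutual information `I(X ; Y | Z)` under `μ`: the Kullback-Leibler divergence of
`P_Z ⊗ P_{(X,Y)|Z}` from `P_Z ⊗ (P_{X|Z} × P_{Y|Z})`. -/
noncomputable def condMutualInfo {Ω E F G : Type*} [MeasurableSpace Ω]
    [MeasurableSpace E] [StandardBorelSpace E] [Nonempty E]
    [MeasurableSpace F] [StandardBorelSpace F] [Nonempty F] [MeasurableSpace G]
    (X : Ω → E) (Y : Ω → F) (Z : Ω → G) (μ : Measure Ω) [IsFiniteMeasure μ] : ℝ≥0∞ :=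
  klDiv ((μ.map Z).compProd (condDistrib (fun ω => (X ω, Y ω)) Z μ))
    ((μ.map Z).compProd ((condDistrib X Z μ).prod (condDistrib Y Z μ)))

/-- The sequential decision problem on a probability space `(Ω, P)`: a parameter `θ`, outcomes
`Y t ω a` of the actions `a` at the times `t = 0, 1, 2, …` and `t = ⊤` (the latter is the
independent copy `Y_∞`), a reward function `R`, and the exogenous randomisation `ξ`. -/
structure BanditModel (Ω Θ Ξ 𝒜 𝒴 : Type*) [MeasurableSpace Ω] [MeasurableSpace Θ]
    [MeasurableSpace Ξ] [MeasurableSpace 𝒜] [MeasurableSpace 𝒴] (P : Measure Ω) where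
  θ : Ω → Θ
  measurable_θ : Measurable θ
  ξ : Ω → Ξ
  measurable_ξ : Measurable ξ
  Y : ℕ∞ → Ω → 𝒜 → 𝒴
  measurable_Y : ∀ t, Measurable fun p : Ω × 𝒜 => Y t p.1 p.2
  R : 𝒴 → ℝ
  measurable_R : Measurable R
  /-- `κ ϑ` is the law of an outcome vector `(Y_{t,a})_a` given `θ = ϑ`. -/
  κ : Kernel Θ (𝒜 → 𝒴)
  isMarkov_κ : IsMarkovKernel κ
  /-- Conditioned on `θ`, the outcome vectors `Y t`, `t ∈ {0, 1, 2, …, ⊤}`, are i.i.d. with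
  law `κ θ`. -/
  cond_iid : ∀ (C : Set Θ) (s : Finset ℕ∞) (B : ℕ∞ → Set (𝒜 → 𝒴)),
    MeasurableSet C → (∀ i, MeasurableSet (B i)) →
      P {ω | θ ω ∈ C ∧ ∀ i ∈ s, Y i ω ∈ B i} =
        ∫⁻ ω in θ ⁻¹' C, ∏ i ∈ s, κ (θ ω) (B i) ∂P
  indep_ξ : IndepFun ξ (fun ω => (θ ω, fun t : ℕ => Y t ω)) P

namespace BanditModel

variable {Ω Θ Ξ 𝒜 𝒴 : Type*} [MeasurableSpace Ω] [MeasurableSpace Θ]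
  [MeasurableSpace Ξ] [MeasurableSpace 𝒜] [MeasurableSpace 𝒴] {P : Measure Ω}

/-- `E[R(Y_{∞,a}) | θ = ϑ]`. -/
noncomputable def meanReward (M : BanditModel Ω Θ Ξ 𝒜 𝒴 P) (ϑ : Θ) (a : 𝒜) : ℝ :=
  ∫ y, M.R (y a) ∂(M.κ ϑ)

/-- The optimal reward `R* = sup_a E[R(Y_{∞,a}) | θ]`. -/
noncomputable def optReward (M : BanditModel Ω Θ Ξ 𝒜 𝒴 P) (ω : Ω) : ℝ :=
  ⨆ a, M.meanReward (M.θ ω) a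

/-- The observation `Y_{t,A_t}`. -/
def obs (M : BanditModel Ω Θ Ξ 𝒜 𝒴 P) (A : ℕ → Ω → 𝒜) (t : ℕ) (ω : Ω) : 𝒴 :=
  M.Y t ω (A t ω)

/-- The reward `R_{t,A_t}`. -/
def reward (M : BanditModel Ω Θ Ξ 𝒜 𝒴 P) (A : ℕ → Ω → 𝒜) (t : ℕ) (ω : Ω) : ℝ :=
  M.R (M.obs A t ω)

/-- The reward `R(Y_{∞,Ã})` of a benchmark action. -/
def benchReward (M : BanditModel Ω Θ Ξ 𝒜 𝒴 P) (Ab : Ω → 𝒜) (ω : Ω) : ℝ :=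
  M.R (M.Y ⊤ ω (Ab ω))

/-- The history `(A_0, Y_{0,A_0}, …, A_{t-1}, Y_{t-1,A_{t-1}})` available at time `t`. -/
def history (M : BanditModel Ω Θ Ξ 𝒜 𝒴 P) (A : ℕ → Ω → 𝒜) (t : ℕ) (ω : Ω) : Fin t → 𝒜 × 𝒴 :=
  fun i => (A i ω, M.obs A i ω)

/-- `A` is generated by a policy: `A_t = π_t(history, ξ)`. -/
def IsPolicyDriven (M : BanditModel Ω Θ Ξ 𝒜 𝒴 P) (A : ℕ → Ω → 𝒜) : Prop :=
  ∃ π : (t : ℕ) → (Fin t → 𝒜 × 𝒴) × Ξ → 𝒜,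
    (∀ t, Measurable (π t)) ∧ ∀ t ω, A t ω = π t (M.history A t ω, M.ξ ω)

/-- `E_t[R̃ - R_{t,A_t}]`, the conditional expectation given the history at time `t`. -/
noncomputable def shortfall (M : BanditModel Ω Θ Ξ 𝒜 𝒴 P) (A : ℕ → Ω → 𝒜) (Ab : Ω → 𝒜) (t : ℕ) :
    Ω → ℝ :=
  P[fun ω => M.benchReward Ab ω - M.reward A t ω |
    MeasurableSpace.comap (M.history A t) inferInstance]

section Information

variable [StandardBorelSpace 𝒜] [Nonempty 𝒜] [StandardBorelSpace 𝒴] [Nonempty 𝒴]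
  [StandardBorelSpace Ξ] [Nonempty Ξ] [IsProbabilityMeasure P]

/-- The random variable `I_t(Ã ; Y_{t,A_t} | ξ)`: the conditional mutual information computed
under the posterior law of `(Ã, Y_{t,A_t}, ξ)` given the history at time `t`. -/
noncomputable def infoGain (M : BanditModel Ω Θ Ξ 𝒜 𝒴 P) (A : ℕ → Ω → 𝒜) (Ab : Ω → 𝒜) (t : ℕ)
    (ω : Ω) : ℝ≥0∞ :=
  condMutualInfo (fun p : 𝒜 × 𝒴 × Ξ => p.1) (fun p => p.2.1) (fun p => p.2.2)
    (condDistrib (fun ω' => (Ab ω', M.obs A t ω', M.ξ ω')) (M.history A t) P (M.history A t ω))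

/-- The discounted information ratio `Γ(Ã, {A_t})`, with values in `[0, ∞]`. Division is that
of `[0, ∞]`: `0 / 0 = 0` and `c / 0 = ∞` for `c > 0`. -/
noncomputable def infoRatio (M : BanditModel Ω Θ Ξ 𝒜 𝒴 P) (α : ℝ) (A : ℕ → Ω → 𝒜)
    (Ab : Ω → 𝒜) : ℝ≥0∞ :=
  ENNReal.ofReal (1 - α ^ 2) * ∑' t : ℕ, ENNReal.ofReal (α ^ (2 * t)) *
    ∫⁻ ω, ENNReal.ofReal (M.shortfall A Ab t ω ^ 2) / M.infoGain A Ab t ω ∂P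

end Information

end BanditModel

/-! Split `R* - R_t = (R* - R̃) + (R̃ - R_t)`. The first difference yields a geometric series. By
the tower property the second contributes at most `∑ α^t E|s_t|`, where `s_t = E_t[R̃ - R_t]`. Write
`|s_t| = √(s_t² / I_t) · √I_t` with `I_t` the information gain. Cauchy-Schwarz over time and sample
space together (`tsum_mul_lintegral_le_sqrt`) bounds the sum by `√(∑ α^(2t) E[s_t² / I_t]) · √(∑ E
I_t)`, and the first radicand is `Γ / (1 - α²)`.

The second radicand is at most `H(Ã | ξ)`. Since `A_t` is a function of the history and `ξ`, only
the observation enlarges the history (`condEntropy_history_succ`), so `E I_t` is the drop of `H(Ã |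
history, ξ)` at time `t`; the drops telescope and the remaining entropy is nonnegative.

The main work is the chain rule in general spaces. Finite conditional entropy makes the conditional
law of `Ã` purely atomic, so the ratio of posterior to prior point masses is a density, and the
chain rule `condEntropy_eq_lintegral_klFun_add` is an integrated identity between logarithms of
masses. Disintegrating that density over the history (`ae_eq_withDensity_of_compProd_eq`) identifies
the information computed under each posterior. -/

/-! ### Point masses and surprisal -/

section Atoms

variable {D E : Type*} [MeasurableSpace D] [MeasurableSpace E]

/-- The surprisal `-log μ{x}` of the point `x`. -/
noncomputable def surprisal (μ : Measure E) (x : E) : ℝ≥0∞ :=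
  (-ENNReal.log (μ {x})).toENNReal

theorem surprisal_eq_top_iff {μ : Measure E} {x : E} : surprisal μ x = ∞ ↔ μ {x} = 0 := by
  rw [surprisal, EReal.toENNReal_eq_top_iff, EReal.neg_eq_top_iff, ENNReal.log_eq_bot_iff]

/-- The diagonal of a standard Borel space is measurable, and `{p.2}` is its section. -/
theorem measurable_kernel_singleton [StandardBorelSpace E] (κ : Kernel D E) [IsSFiniteKernel κ] :
    Measurable fun p : D × E => κ p.1 {p.2} := by
  have hs : MeasurableSet {q : (D × E) × E | q.2 = q.1.2} :=
    measurableSet_eq_fun measurable_snd (measurable_snd.comp measurable_fst)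
  exact Kernel.measurable_kernel_prodMk_left (κ := Kernel.prodMkRight E κ) hs

theorem measurable_surprisal [StandardBorelSpace E] (κ : Kernel D E) [IsSFiniteKernel κ] :
    Measurable fun p : D × E => surprisal (κ p.1) p.2 :=
  (ENNReal.measurable_log.comp (measurable_kernel_singleton κ)).neg.ereal_toENNReal

/-- A finite measure that charges almost all of its points determines every measure absolutely
continuous with respect to it through the ratio of the point masses. -/
theorem eq_withDensity_of_ae_singleton_ne_zero [MeasurableSingletonClass E] {μ ν : Measure E}
    [IsFiniteMeasure ν] (hν : ∀ᵐ x ∂ν, ν {x} ≠ 0) (hμ : ∀ᵐ x ∂μ, ν {x} ≠ 0) :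
    μ = ν.withDensity fun x => μ {x} / ν {x} := by
  set S : Set E := {x | ν {x} ≠ 0} with hS
  -- A finite measure has countably many atoms, so measures carried by `S` are determined by their
  -- point masses.
  have hc : S.Countable := Measure.countable_meas_pos_of_disjoint_iUnion
    (fun x => measurableSet_singleton x) (fun x y hxy => by simpa using hxy) |>.mono
      fun x hx => pos_iff_ne_zero.2 hx
  have hμS : μ Sᶜ = 0 := hμ
  have hνS : ν Sᶜ = 0 := hν
  have hwS : (ν.withDensity fun x => μ {x} / ν {x}) Sᶜ = 0 :=
    withDensity_absolutelyContinuous _ _ hνS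
  ext B hB
  rw [← measure_inter_conull (s := B) hμS, ← measure_inter_conull (s := B) hwS]
  have hBc : (B ∩ S).Countable := hc.mono Set.inter_subset_right
  rw [← Set.biUnion_of_singleton (B ∩ S), measure_biUnion hBc (fun x _ y _ h => by simpa using h)
    (fun x _ => measurableSet_singleton x), measure_biUnion hBc
    (fun x _ y _ h => by simpa using h) (fun x _ => measurableSet_singleton x)]
  refine tsum_congr fun x => ?_
  have hx : ν {(x : E)} ≠ 0 := x.2.2
  rw [withDensity_apply _ (measurableSet_singleton _), lintegral_singleton,
    ENNReal.div_mul_cancel hx (measure_ne_top _ _)]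

/-- The pointwise form of the chain rule: `r log r = r (log p - log q)` for `r = p / q`. -/
theorem div_mul_surprisal_add_one {μ ν : Measure E} [IsProbabilityMeasure μ]
    [IsProbabilityMeasure ν] {x : E} (hx : ν {x} ≠ 0) :
    μ {x} / ν {x} * surprisal ν x + 1 =
      ENNReal.ofReal (klFun (μ {x} / ν {x}).toReal) + μ {x} / ν {x} +
        μ {x} / ν {x} * surprisal μ x := by
  have hs : ∀ (ρ : Measure E) [IsProbabilityMeasure ρ], ρ {x} ≠ 0 →
      surprisal ρ x = ENNReal.ofReal (-Real.log (ρ.real {x})) ∧ 0 ≤ -Real.log (ρ.real {x}) := by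
    intro ρ _ h
    have hlog : ENNReal.log (ρ {x}) = ((Real.log (ρ.real {x}) : ℝ) : EReal) :=
      ENNReal.log_pos_real h (measure_ne_top ρ _)
    have := Real.log_nonpos (measureReal_nonneg (μ := ρ) (s := {x})) measureReal_le_one
    refine ⟨?_, by linarith⟩
    rw [surprisal, hlog, ← EReal.coe_neg, EReal.toENNReal_of_ne_top (by simp)]
    simp
  rcases eq_or_ne (μ {x}) 0 with h | h
  -- Both sides are `1`: `klFun 0 = 1`, and `0 * ∞ = 0` absorbs the infinite surprisal under `μ`.
  · simp [h, klFun_zero]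
  obtain ⟨e1, n1⟩ := hs ν hx
  obtain ⟨e2, n2⟩ := hs μ h
  have p1 : 0 < ν.real {x} := ENNReal.toReal_pos hx (measure_ne_top _ _)
  have p2 : 0 < μ.real {x} := ENNReal.toReal_pos h (measure_ne_top _ _)
  have hr : μ {x} / ν {x} = ENNReal.ofReal (μ.real {x} / ν.real {x}) := by
    rw [ENNReal.ofReal_div_of_pos p1, ofReal_measureReal, ofReal_measureReal]
  have hr0 : 0 ≤ μ.real {x} / ν.real {x} := by positivity
  have hk := klFun_nonneg hr0
  rw [e1, e2, hr, ENNReal.toReal_ofReal hr0, ← ENNReal.ofReal_mul hr0, ← ENNReal.ofReal_mul hr0,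
    ← ENNReal.ofReal_one, ← ENNReal.ofReal_add (by positivity) zero_le_one,
    ← ENNReal.ofReal_add hk hr0, ← ENNReal.ofReal_add (by positivity) (by positivity)]
  congr 1
  rw [klFun_apply, Real.log_div p2.ne' p1.ne']
  ring

theorem klDiv_withDensity {μ : Measure E} [IsFiniteMeasure μ] {f : E → ℝ≥0∞} (hf : Measurable f)
    [IsFiniteMeasure (μ.withDensity f)] :
    klDiv (μ.withDensity f) μ = ∫⁻ x, ENNReal.ofReal (klFun (f x).toReal) ∂μ := by
  rw [klDiv_eq_lintegral_klFun_of_ac (withDensity_absolutelyContinuous _ _)]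
  refine lintegral_congr_ae ?_
  filter_upwards [Measure.rnDeriv_withDensity μ hf] with x hx
  rw [hx]

end Atoms

/-! ### Conditional laws and conditional entropy -/

section CondDistrib

variable {Ω D E G : Type*} [MeasurableSpace Ω] [MeasurableSpace D]
  [MeasurableSpace E] [StandardBorelSpace E] [Nonempty E]
  [MeasurableSpace G] [StandardBorelSpace G] [Nonempty G]
  {P : Measure Ω} [IsProbabilityMeasure P]

/-- Integrating over the disintegrated law of `(W, X)` turns the iterated integral into one
expectation, in which entropies with different conditioning can be compared. -/
theorem condEntropy_eq_lintegral_surprisal {X : Ω → E} {W : Ω → D} (hX : Measurable X)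
    (hW : Measurable W) :
    condEntropy X W P = ∫⁻ ω, surprisal (condDistrib X W P (W ω)) (X ω) ∂P := by
  have hm := measurable_surprisal (condDistrib X W P)
  have h : ∫⁻ p, surprisal (condDistrib X W P p.1) p.2 ∂(P.map fun ω => (W ω, X ω)) =
      ∫⁻ ω, surprisal (condDistrib X W P (W ω)) (X ω) ∂P :=
    lintegral_map hm (hW.prodMk hX)
  rw [← h, ← compProd_map_condDistrib hX.aemeasurable, Measure.lintegral_compProd hm,
    lintegral_map hm.lintegral_kernel_prod_right' hW]
  rfl

/-- Conditional entropy depends on the conditioning variable only up to an invertible recoding. -/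
theorem condEntropy_comp_of_leftInverse {D' : Type*} [MeasurableSpace D'] {X : Ω → E} {W : Ω → D}
    (hX : Measurable X) (hW : Measurable W) {φ : D → D'} {ψ : D' → D} (hφ : Measurable φ)
    (hψ : Measurable ψ) (h : Function.LeftInverse ψ φ) :
    condEntropy X (φ ∘ W) P = condEntropy X W P := by
  have hκ : condDistrib X (φ ∘ W) P =ᵐ[P.map (φ ∘ W)] (condDistrib X W P).comap ψ hψ := by
    refine condDistrib_ae_eq_of_measure_eq_compProd _ hX.aemeasurable ?_
    have hc : HasCondDistrib X W (((condDistrib X W P).comap ψ hψ).comap φ hφ) P := by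
      refine ⟨by fun_prop, ?_⟩
      rw [← Kernel.comap_comp_right]
      simp only [h.comp_eq_id]
      rw [← compProd_map_condDistrib hX.aemeasurable]
      rfl
    exact hc.comp_right.map_eq
  rw [condEntropy, condEntropy]
  refine lintegral_congr_ae ?_
  filter_upwards [ae_of_ae_map (hφ.comp hW).aemeasurable hκ] with ω hω
  rw [hω, Kernel.comap_apply, Function.comp_apply, h]

/-- Both kernels disintegrate the law of `(F, Z, X)` over `F`, by associativity of the composition
product, and disintegrations are a.e. unique. -/
theorem condDistrib_prod_ae_eq_compProd {F : Ω → D} {Z : Ω → G} {X : Ω → E} (hF : Measurable F)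
    (hZ : Measurable Z) (hX : Measurable X) :
    condDistrib (fun ω => (Z ω, X ω)) F P =ᵐ[P.map F]
      condDistrib Z F P ⊗ₖ condDistrib X (fun ω => (F ω, Z ω)) P := by
  refine condDistrib_ae_eq_of_measure_eq_compProd _ (by fun_prop) ?_
  rw [← Measure.compProd_assoc', compProd_map_condDistrib hZ.aemeasurable,
    compProd_map_condDistrib hX.aemeasurable, Measure.map_map (by fun_prop) (by fun_prop)]
  rfl

/-- Conditioning the posterior given `F = h` on `Z` yields the conditional law given `(F, Z)`. -/
theorem ae_condDistrib_condDistrib {T : Type*} [MeasurableSpace T] [StandardBorelSpace T]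
    [Nonempty T] {F : Ω → D} {V : Ω → T} (hF : Measurable F) (hV : Measurable V)
    {x : T → E} {z : T → G} (hx : Measurable x) (hz : Measurable z) :
    ∀ᵐ h ∂P.map F, condDistrib x z (condDistrib V F P h) =ᵐ[(condDistrib V F P h).map z]
      (condDistrib (x ∘ V) (fun ω => (F ω, z (V ω))) P).sectR h := by
  filter_upwards [condDistrib_comp (μ := P) F hV.aemeasurable hz,
    condDistrib_comp (μ := P) F hV.aemeasurable (hz.prodMk hx),
    condDistrib_prod_ae_eq_compProd (P := P) hF (hz.comp hV) (hx.comp hV)] with h h1 h2 h3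
  refine condDistrib_ae_eq_of_measure_eq_compProd _ hx.aemeasurable ?_
  rw [Kernel.map_apply _ hz] at h1
  rw [Kernel.map_apply _ (hz.prodMk hx)] at h2
  rw [← h1, ← h2, ← Kernel.compProd_apply_eq_compProd_sectR]
  exact h3

end CondDistrib

/-! ### The likelihood ratio and disintegration of densities -/

section PosteriorRatio

variable {Ω D E : Type*} [MeasurableSpace Ω] [MeasurableSpace D]
  [MeasurableSpace E] [StandardBorelSpace E] [Nonempty E]
  {P : Measure Ω} [IsProbabilityMeasure P]

/-- A finite expected surprisal is a.e. finite, and surprisal is infinite exactly at points of zero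
mass. -/
theorem ae_singleton_ne_zero_of_condEntropy_ne_top {X : Ω → E} {W : Ω → D} (hX : Measurable X)
    (hW : Measurable W) (hH : condEntropy X W P ≠ ∞) :
    ∀ᵐ p ∂P.map (fun ω => (W ω, X ω)), condDistrib X W P p.1 {p.2} ≠ 0 := by
  have hm := measurable_surprisal (condDistrib X W P)
  rw [condEntropy_eq_lintegral_surprisal hX hW,
    ← lintegral_map (f := fun p : D × E => surprisal (condDistrib X W P p.1) p.2) hm
      (hW.prodMk hX)] at hH
  filter_upwards [ae_lt_top hm hH] with p hp
  exact fun h0 => hp.ne (surprisal_eq_top_iff.2 h0)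

variable {L : Type*} [MeasurableSpace L]

variable (P) in
/-- The likelihood ratio `P(X = x | W, Y) / P(X = x | W)` at the point `(W, x, Y)`. -/
noncomputable def posteriorRatio (X : Ω → E) (W : Ω → D) (Y : Ω → L) (p : D × E × L) : ℝ≥0∞ :=
  condDistrib X (fun ω => (W ω, Y ω)) P (p.1, p.2.2) {p.2.1} / condDistrib X W P p.1 {p.2.1}

theorem measurable_posteriorRatio (X : Ω → E) (W : Ω → D) (Y : Ω → L) :
    Measurable (posteriorRatio P X W Y) :=
  ((measurable_kernel_singleton (condDistrib X (fun ω => (W ω, Y ω)) P)).comp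
    (by fun_prop : Measurable fun p : D × E × L => ((p.1, p.2.2), p.2.1))).div
  ((measurable_kernel_singleton (condDistrib X W P)).comp
    (by fun_prop : Measurable fun p : D × E × L => (p.1, p.2.1)))

end PosteriorRatio

/-- Disintegration of a density: if `μ ⊗ₘ κ` has density `r` with respect to `μ ⊗ₘ η`, then almost
every `κ a` has density `r a` with respect to `η a`. -/
theorem ae_eq_withDensity_of_compProd_eq {D T : Type*} [MeasurableSpace D] [MeasurableSpace T]
    [MeasurableSpace.CountableOrCountablyGenerated D T] {μ : Measure D} [IsFiniteMeasure μ]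
    {κ η : Kernel D T} [IsFiniteKernel κ] [IsFiniteKernel η] {r : D → T → ℝ≥0∞}
    (hr : Measurable (Function.uncurry r))
    (h : μ ⊗ₘ κ = (μ ⊗ₘ η).withDensity fun p => r p.1 p.2) :
    ∀ᵐ a ∂μ, κ a = (η a).withDensity (r a) := by
  have h_ac : ∀ᵐ a ∂μ, κ a ≪ η a :=
    (h ▸ withDensity_absolutelyContinuous _ _ : μ ⊗ₘ κ ≪ μ ⊗ₘ η).kernel_of_compProd
  have hκ : ∀ᵐ a ∂μ, κ a = η.withDensity (κ.rnDeriv η) a := by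
    filter_upwards [h_ac] with a ha using (Kernel.withDensity_rnDeriv_eq ha).symm
  have hm : Measurable (Function.uncurry (κ.rnDeriv η)) := Kernel.measurable_rnDeriv κ η
  have heq : (μ ⊗ₘ η).withDensity (fun p => κ.rnDeriv η p.1 p.2) =
      (μ ⊗ₘ η).withDensity fun p => r p.1 p.2 := by
    rw [← h, Measure.compProd_congr hκ, Measure.compProd_withDensity hm]
  -- Densities are a.e. unique only under a finiteness condition, supplied here by the finite mass
  -- of `μ ⊗ₘ κ`.
  have hfin : ∫⁻ p, κ.rnDeriv η p.1 p.2 ∂(μ ⊗ₘ η) ≠ ∞ := by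
    rw [← setLIntegral_univ, ← withDensity_apply _ MeasurableSet.univ, heq, ← h]
    exact measure_ne_top _ _
  have hae := Measure.ae_ae_of_ae_compProd
    ((withDensity_eq_iff hm.aemeasurable hr.aemeasurable hfin).1 heq)
  filter_upwards [hκ, hae] with a ha hra
  rw [ha, Kernel.withDensity_apply _ hm]
  exact withDensity_congr_ae hra

/-! ### The chain rule for entropy and mutual information -/

section ChainRule

variable {Ω D E G L : Type*} [MeasurableSpace Ω] [MeasurableSpace D]
  [MeasurableSpace E] [StandardBorelSpace E] [Nonempty E]
  [MeasurableSpace G] [StandardBorelSpace G] [Nonempty G]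
  [MeasurableSpace L] [StandardBorelSpace L] [Nonempty L]
  {P : Measure Ω} [IsProbabilityMeasure P]

/-- The mutual information computed under the posterior given `F = h` is the divergence of the
posterior law of `(Z, X, Y)` from the law that makes `X`, `Y` conditionally independent. -/
theorem ae_condMutualInfo_condDistrib {F : Ω → D} {Z : Ω → G} {X : Ω → E} {Y : Ω → L}
    (hF : Measurable F) (hZ : Measurable Z) (hX : Measurable X) (hY : Measurable Y) :
    ∀ᵐ h ∂P.map F,
      condMutualInfo (fun p : E × L × G => p.1) (fun p => p.2.1) (fun p => p.2.2)
        (condDistrib (fun ω => (X ω, Y ω, Z ω)) F P h) =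
      klDiv (condDistrib (fun ω => (Z ω, X ω, Y ω)) F P h)
        ((condDistrib Z F P ⊗ₖ (condDistrib X (fun ω => (F ω, Z ω)) P ×ₖ
          condDistrib Y (fun ω => (F ω, Z ω)) P)) h) := by
  have hV : Measurable fun ω => (X ω, Y ω, Z ω) := by fun_prop
  have hz : Measurable fun p : E × L × G => p.2.2 := by fun_prop
  have hr : Measurable fun p : E × L × G => (p.2.2, p.1, p.2.1) := by fun_prop
  filter_upwards [condDistrib_comp (μ := P) F hV.aemeasurable hr,
    condDistrib_comp (μ := P) F hV.aemeasurable hz,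
    ae_condDistrib_condDistrib (P := P) hF hV (x := fun p : E × L × G => p.1) (by fun_prop) hz,
    ae_condDistrib_condDistrib (P := P) hF hV (x := fun p : E × L × G => p.2.1) (by fun_prop) hz]
    with h h1 h2 h3 h4
  rw [Kernel.map_apply _ hr] at h1
  rw [Kernel.map_apply _ hz] at h2
  rw [condMutualInfo, compProd_map_condDistrib (by fun_prop), ← h1,
    Kernel.compProd_apply_eq_compProd_sectR]
  congr 1
  rw [← h2]
  refine Measure.compProd_congr ?_
  rw [h2]
  filter_upwards [h3, h4] with z h3 h4
  have hp : (condDistrib X (fun ω => (F ω, Z ω)) P ×ₖ condDistrib Y (fun ω => (F ω, Z ω)) P).sectR h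
      z = (condDistrib X (fun ω => (F ω, Z ω)) P (h, z)).prod
        (condDistrib Y (fun ω => (F ω, Z ω)) P (h, z)) := by
    rw [Kernel.sectR_apply, Kernel.prod_apply]
  rw [Kernel.prod_apply, h3, h4, hp]
  rfl

/-- The joint law of `(W, X, Y)` has density `posteriorRatio` with respect to the law that makes
`X` and `Y` conditionally independent given `W`. -/
theorem map_eq_withDensity_posteriorRatio {X : Ω → E} {W : Ω → D} {Y : Ω → L} (hX : Measurable X)
    (hW : Measurable W) (hY : Measurable Y) (hH : condEntropy X W P ≠ ∞) :
    P.map (fun ω => (W ω, X ω, Y ω)) =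
      (P.map W ⊗ₘ (condDistrib X W P ×ₖ condDistrib Y W P)).withDensity
        (posteriorRatio P X W Y) := by
  have hat := ae_singleton_ne_zero_of_condEntropy_ne_top hX hW hH
  have hms : MeasurableSet {p : D × E | condDistrib X W P p.1 {p.2} ≠ 0} :=
    (measurable_kernel_singleton _) (measurableSet_singleton 0).compl
  -- Almost surely the prior charges almost every point, both under itself (`h1`) and under the
  -- posterior given `(W, Y)` (`h2`); hence the posterior has the ratio of point masses as density.
  have h1 : ∀ᵐ q ∂P.map (fun ω => (W ω, Y ω)), ∀ᵐ x ∂condDistrib X W P q.1,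
      condDistrib X W P q.1 {x} ≠ 0 := by
    have : ∀ᵐ w ∂(P.map fun ω => (W ω, Y ω)).map Prod.fst, ∀ᵐ x ∂condDistrib X W P w,
        condDistrib X W P w {x} ≠ 0 := by
      rw [Measure.map_map measurable_fst (hW.prodMk hY)]
      rw [← compProd_map_condDistrib hX.aemeasurable] at hat
      exact Measure.ae_ae_of_ae_compProd hat
    exact ae_of_ae_map measurable_fst.aemeasurable this
  have h2 : ∀ᵐ q ∂P.map (fun ω => (W ω, Y ω)),
      ∀ᵐ x ∂condDistrib X (fun ω => (W ω, Y ω)) P q, condDistrib X W P q.1 {x} ≠ 0 := by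
    refine Measure.ae_ae_of_ae_compProd (p := fun p : (D × L) × E =>
      condDistrib X W P p.1.1 {p.2} ≠ 0) ?_
    rw [compProd_map_condDistrib hX.aemeasurable]
    rw [ae_map_iff (by fun_prop) hms] at hat
    rw [ae_map_iff (by fun_prop)]
    · exact hat
    · exact (by fun_prop : Measurable fun p : (D × L) × E => (p.1.1, p.2)) hms
  have hR := measurable_posteriorRatio (P := P) X W Y
  ext s hs
  have hg : Measurable (s.indicator (posteriorRatio P X W Y)) := hR.indicator hs
  have hi : Measurable (s.indicator (1 : D × E × L → ℝ≥0∞)) := measurable_one.indicator hs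
  rw [withDensity_apply _ hs, ← lintegral_indicator hs, Measure.lintegral_compProd hg]
  -- Integrating over `x` innermost leaves `(w, y)` fixed, so that the atomic density applies to
  -- each posterior.
  have hrhs : ∀ w, ∫⁻ b, s.indicator (posteriorRatio P X W Y) (w, b)
      ∂(condDistrib X W P ×ₖ condDistrib Y W P) w =
      ∫⁻ y, ∫⁻ x, s.indicator (posteriorRatio P X W Y) (w, x, y) ∂condDistrib X W P w
        ∂condDistrib Y W P w := by
    intro w
    rw [Kernel.prod_apply]
    exact lintegral_prod_symm' _ (hg.comp measurable_prodMk_left)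
  simp_rw [hrhs]
  have hrm : Measurable fun q : D × L => ∫⁻ x, s.indicator (posteriorRatio P X W Y)
      (q.1, x, q.2) ∂condDistrib X W P q.1 :=
    (hg.comp (by fun_prop : Measurable fun r : (D × L) × E => (r.1.1, r.2, r.1.2))
      ).lintegral_kernel_prod_right' (κ := (condDistrib X W P).prodMkRight L)
  rw [← Measure.lintegral_compProd (f := fun q : D × L =>
    ∫⁻ x, s.indicator (posteriorRatio P X W Y) (q.1, x, q.2) ∂condDistrib X W P q.1) hrm,
    compProd_map_condDistrib hY.aemeasurable]
  have hi' : Measurable fun p : (D × L) × E =>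
      s.indicator (1 : D × E × L → ℝ≥0∞) (p.1.1, p.2, p.1.2) := hi.comp (by fun_prop)
  have hl : P.map (fun ω => (W ω, X ω, Y ω)) s =
      ∫⁻ p : (D × L) × E, s.indicator 1 (p.1.1, p.2, p.1.2)
        ∂P.map (fun ω => ((W ω, Y ω), X ω)) := by
    rw [lintegral_map hi' (by fun_prop), ← lintegral_indicator_one hs,
      lintegral_map hi (by fun_prop)]
  rw [hl, ← compProd_map_condDistrib hX.aemeasurable, Measure.lintegral_compProd hi']
  refine lintegral_congr_ae ?_
  filter_upwards [h1, h2] with q h1 h2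
  have hRq : Measurable fun x => posteriorRatio P X W Y (q.1, x, q.2) := hR.comp (by fun_prop)
  have hiq : Measurable fun x => s.indicator (1 : D × E × L → ℝ≥0∞) (q.1, x, q.2) :=
    hi.comp (by fun_prop)
  have hq := eq_withDensity_of_ae_singleton_ne_zero h1 h2
  rw [hq]
  refine (lintegral_withDensity_eq_lintegral_mul _ hRq hiq).trans (lintegral_congr fun x => ?_)
  by_cases hx : (q.1, x, q.2) ∈ s <;> simp [hx]

/-- The chain rule `H(X | W) = I(X ; Y | W) + H(X | W, Y)`. -/
theorem condEntropy_eq_lintegral_klFun_add {X : Ω → E} {W : Ω → D} {Y : Ω → L} (hX : Measurable X)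
    (hW : Measurable W) (hY : Measurable Y) (hH : condEntropy X W P ≠ ∞) :
    condEntropy X W P =
      ∫⁻ p, ENNReal.ofReal (klFun (posteriorRatio P X W Y p).toReal)
        ∂(P.map W ⊗ₘ (condDistrib X W P ×ₖ condDistrib Y W P)) +
      condEntropy X (fun ω => (W ω, Y ω)) P := by
  set ν := P.map W ⊗ₘ (condDistrib X W P ×ₖ condDistrib Y W P) with hν
  have : IsProbabilityMeasure (P.map W) := Measure.isProbabilityMeasure_map hW.aemeasurable
  have hR := measurable_posteriorRatio (P := P) X W Y
  have hmap := map_eq_withDensity_posteriorRatio hX hW hY hH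
  have hs : Measurable fun p : D × E × L => surprisal (condDistrib X W P p.1) p.2.1 :=
    (measurable_surprisal (condDistrib X W P)).comp
      (by fun_prop : Measurable fun p : D × E × L => (p.1, p.2.1))
  have hs' : Measurable fun p : D × E × L =>
      surprisal (condDistrib X (fun ω => (W ω, Y ω)) P (p.1, p.2.2)) p.2.1 :=
    (measurable_surprisal (condDistrib X (fun ω => (W ω, Y ω)) P)).comp
      (by fun_prop : Measurable fun p : D × E × L => ((p.1, p.2.2), p.2.1))
  have key : ∀ f : D × E × L → ℝ≥0∞, Measurable f →
      ∫⁻ ω, f (W ω, X ω, Y ω) ∂P = ∫⁻ p, posteriorRatio P X W Y p * f p ∂ν := by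
    intro f hf
    rw [← lintegral_map hf (by fun_prop), hmap]
    exact lintegral_withDensity_eq_lintegral_mul _ hR hf
  -- The conditionally independent law has the same `(W, X)` marginal as the true one.
  have hat : ∀ᵐ p ∂ν, condDistrib X W P p.1 {p.2.1} ≠ 0 := by
    have h := ae_singleton_ne_zero_of_condEntropy_ne_top hX hW hH
    have hfst : ν.map (fun p : D × E × L => (p.1, p.2.1)) = P.map (fun ω => (W ω, X ω)) := by
      rw [← compProd_map_condDistrib hX.aemeasurable]
      ext s hs
      rw [Measure.map_apply (by fun_prop) hs, Measure.compProd_apply hs, hν,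
        Measure.compProd_apply (hs.preimage (by fun_prop))]
      refine lintegral_congr fun w => ?_
      have : (Prod.mk w ⁻¹' ((fun p : D × E × L => (p.1, p.2.1)) ⁻¹' s)) =
          (Prod.mk w ⁻¹' s) ×ˢ (Set.univ : Set L) := by
        ext q; simp
      rw [this, Kernel.prod_apply, Measure.prod_prod, measure_univ, mul_one]
    rw [← hfst] at h
    exact ae_of_ae_map (f := fun p : D × E × L => (p.1, p.2.1)) (by fun_prop) h
  have hadd : ∫⁻ p, posteriorRatio P X W Y p * surprisal (condDistrib X W P p.1) p.2.1 + 1 ∂ν =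
      ∫⁻ p, ENNReal.ofReal (klFun (posteriorRatio P X W Y p).toReal) + posteriorRatio P X W Y p +
        posteriorRatio P X W Y p *
          surprisal (condDistrib X (fun ω => (W ω, Y ω)) P (p.1, p.2.2)) p.2.1 ∂ν := by
    refine lintegral_congr_ae ?_
    filter_upwards [hat] with p hp
    exact div_mul_surprisal_add_one hp
  have hk : Measurable fun p => ENNReal.ofReal (klFun (posteriorRatio P X W Y p).toReal) :=
    (measurable_klFun.comp hR.ennreal_toReal).ennreal_ofReal
  have hRs' : Measurable fun p : D × E × L => posteriorRatio P X W Y p *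
      surprisal (condDistrib X (fun ω => (W ω, Y ω)) P (p.1, p.2.2)) p.2.1 := hR.mul hs'
  -- The constant `1` and the ratio both have `ν`-integral `1`; these finite terms cancel in `hadd`,
  -- leaving the chain rule without subtraction in `ℝ≥0∞`.
  have hone : ∫⁻ p, posteriorRatio P X W Y p ∂ν = 1 := by
    have := key 1 measurable_one
    simpa using this.symm
  rw [lintegral_add_right _ measurable_const, lintegral_add_right _ hRs', lintegral_add_left hk,
    ← key _ hs, ← key _ hs', hone, lintegral_const, measure_univ, one_mul, add_right_comm] at hadd
  rw [condEntropy_eq_lintegral_surprisal hX hW,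
    condEntropy_eq_lintegral_surprisal hX (hW.prodMk hY)]
  exact (ENNReal.add_left_inj ENNReal.one_ne_top).1 hadd

/-- The information about `X` gained from `Y` under the posterior given `F`, averaged over `F`,
is the decrease of the conditional entropy. -/
theorem condEntropy_eq_lintegral_condMutualInfo_add {F : Ω → D} {Z : Ω → G} {X : Ω → E} {Y : Ω → L}
    (hF : Measurable F) (hZ : Measurable Z) (hX : Measurable X) (hY : Measurable Y)
    (hH : condEntropy X (fun ω => (F ω, Z ω)) P ≠ ∞) :
    AEMeasurable (fun ω => condMutualInfo (fun p : E × L × G => p.1) (fun p => p.2.1)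
        (fun p => p.2.2) (condDistrib (fun ω => (X ω, Y ω, Z ω)) F P (F ω))) P ∧
    condEntropy X (fun ω => (F ω, Z ω)) P =
      ∫⁻ ω, condMutualInfo (fun p : E × L × G => p.1) (fun p => p.2.1)
        (fun p => p.2.2) (condDistrib (fun ω => (X ω, Y ω, Z ω)) F P (F ω)) ∂P +
      condEntropy X (fun ω => ((F ω, Z ω), Y ω)) P := by
  set W : Ω → D × G := fun ω => (F ω, Z ω) with hWdef
  have hW : Measurable W := hF.prodMk hZ
  have : IsProbabilityMeasure (P.map F) := Measure.isProbabilityMeasure_map hF.aemeasurable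
  set η : Kernel D (G × E × L) :=
    condDistrib Z F P ⊗ₖ (condDistrib X W P ×ₖ condDistrib Y W P) with hη
  set r : D → G × E × L → ℝ≥0∞ := fun h q => posteriorRatio P X W Y ((h, q.1), q.2) with hr
  have hrm : Measurable (Function.uncurry r) :=
    (measurable_posteriorRatio (P := P) X W Y).comp
      (by fun_prop : Measurable fun p : D × G × E × L => ((p.1, p.2.1), p.2.2))
  have hk : Measurable fun p : D × G × E × L => ENNReal.ofReal (klFun (r p.1 p.2).toReal) :=
    (measurable_klFun.comp hrm.ennreal_toReal).ennreal_ofReal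
  have hassoc : (P.map F ⊗ₘ η) =
      (P.map W ⊗ₘ (condDistrib X W P ×ₖ condDistrib Y W P)).map MeasurableEquiv.prodAssoc := by
    rw [hη, ← Measure.compProd_assoc', compProd_map_condDistrib hZ.aemeasurable]
  have hlaw : P.map F ⊗ₘ condDistrib (fun ω => (Z ω, X ω, Y ω)) F P =
      (P.map F ⊗ₘ η).withDensity fun p => r p.1 p.2 := by
    rw [compProd_map_condDistrib (by fun_prop), hassoc]
    have : P.map (fun ω => (F ω, Z ω, X ω, Y ω)) =
        (P.map fun ω => (W ω, X ω, Y ω)).map MeasurableEquiv.prodAssoc := by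
      rw [Measure.map_map (by fun_prop) (by fun_prop)]
      rfl
    rw [this, map_eq_withDensity_posteriorRatio hX hW hY hH]
    ext s hs
    rw [Measure.map_apply (by fun_prop) hs,
      withDensity_apply _ (hs.preimage (MeasurableEquiv.measurable _)), withDensity_apply _ hs]
    exact (setLIntegral_map hs hrm (MeasurableEquiv.measurable _)).symm
  have hpost := ae_eq_withDensity_of_compProd_eq hrm hlaw
  have hI : (fun h => condMutualInfo (fun p : E × L × G => p.1) (fun p => p.2.1)
        (fun p => p.2.2) (condDistrib (fun ω => (X ω, Y ω, Z ω)) F P h)) =ᵐ[P.map F]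
      fun h => ∫⁻ q, ENNReal.ofReal (klFun (r h q).toReal) ∂η h := by
    filter_upwards [ae_condMutualInfo_condDistrib (P := P) hF hZ hX hY, hpost] with h h1 h2
    have : IsFiniteMeasure ((η h).withDensity (r h)) := by rw [← h2]; infer_instance
    rw [h1, h2]
    exact klDiv_withDensity (hrm.comp measurable_prodMk_left)
  have hIω := ae_of_ae_map hF.aemeasurable hI
  -- The information is a.e. equal to a kernel integral of a jointly measurable function; this is
  -- the source of its a.e. measurability.
  refine ⟨⟨_, hk.lintegral_kernel_prod_right'.comp hF, hIω⟩, ?_⟩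
  rw [lintegral_congr_ae hIω, condEntropy_eq_lintegral_klFun_add hX hW hY hH,
    ← lintegral_map hk.lintegral_kernel_prod_right' hF, ← Measure.lintegral_compProd hk, hassoc,
    lintegral_map hk (by fun_prop)]
  rfl

end ChainRule

/-! ### Cauchy-Schwarz inequalities -/

section CauchySchwarz

/-- Cauchy-Schwarz in the form `E s ≤ √(E [s² / I]) √(E I)`. -/
theorem lintegral_le_sqrt_lintegral_sq_div_mul {Ω : Type*} [MeasurableSpace Ω] {P : Measure Ω}
    {s I : Ω → ℝ≥0∞} (hs : AEMeasurable s P) (hI : AEMeasurable I P)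
    (hdiv : ∫⁻ ω, s ω ^ 2 / I ω ∂P ≠ ∞) (hItop : ∫⁻ ω, I ω ∂P ≠ ∞) :
    ∫⁻ ω, s ω ∂P ≤
      (∫⁻ ω, s ω ^ 2 / I ω ∂P) ^ (1 / 2 : ℝ) * (∫⁻ ω, I ω ∂P) ^ (1 / 2 : ℝ) := by
  have hd : AEMeasurable (fun ω => s ω ^ 2 / I ω) P := (hs.pow_const 2).div hI
  have hsq : ∀ x : ℝ≥0∞, (x ^ (1 / 2 : ℝ)) ^ (2 : ℝ) = x := fun x => by
    rw [← ENNReal.rpow_mul]; norm_num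
  have h := ENNReal.lintegral_mul_le_Lp_mul_Lq P Real.HolderConjugate.two_two
    (hd.pow_const (1 / 2 : ℝ)) (hI.pow_const (1 / 2 : ℝ))
  simp only [hsq] at h
  refine le_trans (lintegral_mono_ae ?_) h
  filter_upwards [ae_lt_top' hd hdiv, ae_lt_top' hI hItop] with ω h1 h2
  rw [Pi.mul_apply, ← ENNReal.mul_rpow_of_nonneg _ _ (by norm_num)]
  -- Where `I` vanishes, finiteness of `s² / I` forces `s = 0`, because `c / 0 = ∞` for `c > 0`.
  rcases eq_or_ne (I ω) 0 with h0 | h0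
  · have : s ω = 0 := by
      by_contra hne
      rw [h0, ENNReal.div_zero (pow_ne_zero 2 hne)] at h1
      exact h1.ne rfl
    simp [this]
  · rw [ENNReal.div_mul_cancel h0 h2.ne, ← ENNReal.rpow_natCast, ← ENNReal.rpow_mul]
    norm_num

theorem ENNReal.tsum_sqrt_mul_sqrt_le {ι : Type*} (x y : ι → ℝ≥0∞) :
    ∑' i, x i ^ (1 / 2 : ℝ) * y i ^ (1 / 2 : ℝ) ≤
      (∑' i, x i) ^ (1 / 2 : ℝ) * (∑' i, y i) ^ (1 / 2 : ℝ) := by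
  let _ : MeasurableSpace ι := ⊤
  have hsq : ∀ x : ℝ≥0∞, (x ^ (1 / 2 : ℝ)) ^ (2 : ℝ) = x := fun x => by
    rw [← ENNReal.rpow_mul]; norm_num
  have h := ENNReal.lintegral_mul_le_Lp_mul_Lq Measure.count Real.HolderConjugate.two_two
    (f := fun i => x i ^ (1 / 2 : ℝ)) (g := fun i => y i ^ (1 / 2 : ℝ))
    measurable_from_top.aemeasurable measurable_from_top.aemeasurable
  simpa only [hsq, lintegral_count, Pi.mul_apply] using h

/-- The discounted Cauchy-Schwarz inequality over time and sample space. -/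
theorem tsum_mul_lintegral_le_sqrt {Ω : Type*} [MeasurableSpace Ω] {P : Measure Ω}
    {s I : ℕ → Ω → ℝ≥0∞} {c : ℕ → ℝ≥0∞} (hs : ∀ t, AEMeasurable (s t) P)
    (hI : ∀ t, AEMeasurable (I t) P)
    (hdiv : ∑' t, c t ^ 2 * ∫⁻ ω, s t ω ^ 2 / I t ω ∂P ≠ ∞)
    (hItop : ∑' t, ∫⁻ ω, I t ω ∂P ≠ ∞) :
    ∑' t, c t * ∫⁻ ω, s t ω ∂P ≤
      (∑' t, c t ^ 2 * ∫⁻ ω, s t ω ^ 2 / I t ω ∂P) ^ (1 / 2 : ℝ) *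
        (∑' t, ∫⁻ ω, I t ω ∂P) ^ (1 / 2 : ℝ) := by
  refine le_trans (ENNReal.tsum_le_tsum fun t => ?_) (ENNReal.tsum_sqrt_mul_sqrt_le _ _)
  -- A zero weight hides a possibly infinite integral, but then the left-hand term is zero as well.
  rcases eq_or_ne (c t) 0 with h0 | h0
  · simp [h0]
  have hd : ∫⁻ ω, s t ω ^ 2 / I t ω ∂P ≠ ∞ := fun h =>
    ENNReal.ne_top_of_tsum_ne_top hdiv t (by rw [h, ENNReal.mul_top (pow_ne_zero 2 h0)])
  have hc : (c t ^ 2) ^ (1 / 2 : ℝ) = c t := by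
    rw [← ENNReal.rpow_natCast, ← ENNReal.rpow_mul]; norm_num
  rw [ENNReal.mul_rpow_of_nonneg _ _ (by norm_num), hc, mul_assoc]
  gcongr
  exact lintegral_le_sqrt_lintegral_sq_div_mul (hs t) (hI t) hd
    (ENNReal.ne_top_of_tsum_ne_top hItop t)

end CauchySchwarz

/-! ### Entropy along the history and the information ratio -/

namespace BanditModel

section Measurability

variable {Ω Θ Ξ 𝒜 𝒴 : Type*} [MeasurableSpace Ω] [MeasurableSpace Θ]
  [MeasurableSpace Ξ] [MeasurableSpace 𝒜] [MeasurableSpace 𝒴] {P : Measure Ω}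
  {M : BanditModel Ω Θ Ξ 𝒜 𝒴 P} {A : ℕ → Ω → 𝒜}

theorem measurable_obs {t : ℕ} (h : Measurable (A t)) : Measurable (M.obs A t) :=
  (M.measurable_Y t).comp (measurable_id.prodMk h)

theorem measurable_history {t : ℕ} (h : ∀ i < t, Measurable (A i)) :
    Measurable (M.history A t) :=
  measurable_pi_lambda _ fun i => (h i i.2).prodMk (measurable_obs (h i i.2))

theorem IsPolicyDriven.measurable_action (hA : M.IsPolicyDriven A) (t : ℕ) :
    Measurable (A t) := by
  obtain ⟨π, hπ, hAπ⟩ := hA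
  induction t using Nat.strong_induction_on with
  | _ t ih =>
    rw [show A t = fun ω => π t (M.history A t ω, M.ξ ω) from funext (hAπ t)]
    exact (hπ t).comp ((measurable_history ih).prodMk M.measurable_ξ)

end Measurability

section Information

variable {Ω Θ Ξ 𝒜 𝒴 : Type*} [MeasurableSpace Ω] [MeasurableSpace Θ]
  [MeasurableSpace Ξ] [MeasurableSpace 𝒜] [MeasurableSpace 𝒴] {P : Measure Ω}
  [StandardBorelSpace 𝒜] [Nonempty 𝒜] [IsProbabilityMeasure P]
  {M : BanditModel Ω Θ Ξ 𝒜 𝒴 P} {A : ℕ → Ω → 𝒜} {Ab : Ω → 𝒜}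

theorem condEntropy_history_zero (hAb : Measurable Ab) :
    condEntropy Ab (fun ω => (M.history A 0 ω, M.ξ ω)) P = condEntropy Ab M.ξ P := by
  have h := condEntropy_comp_of_leftInverse (P := P) hAb M.measurable_ξ
    (φ := fun z => ((Fin.elim0 : Fin 0 → 𝒜 × 𝒴), z)) (ψ := Prod.snd) (by fun_prop) (by fun_prop)
    fun _ => rfl
  rw [← h]
  congr 1
  funext ω
  exact Prod.ext (Subsingleton.elim _ _) rfl

/-- As `A_t` is a function of the history and `ξ`, the history at time `t + 1` carries the same
information as the history at time `t` and the observation `Y_{t,A_t}`. -/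
theorem condEntropy_history_succ (hA : M.IsPolicyDriven A) (hAb : Measurable Ab) (t : ℕ) :
    condEntropy Ab (fun ω => (M.history A (t + 1) ω, M.ξ ω)) P =
      condEntropy Ab (fun ω => ((M.history A t ω, M.ξ ω), M.obs A t ω)) P := by
  have hm := hA.measurable_action
  obtain ⟨π, hπ, hAπ⟩ := hA
  have hW : Measurable fun ω => ((M.history A t ω, M.ξ ω), M.obs A t ω) :=
    ((measurable_history fun i _ => hm i).prodMk M.measurable_ξ).prodMk (measurable_obs (hm t))
  -- `φ` reconstructs the action `A_t` through the policy `π t` and appends it with the observation;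
  -- `ψ` forgets that action.
  let φ : ((Fin t → 𝒜 × 𝒴) × Ξ) × 𝒴 → (Fin (t + 1) → 𝒜 × 𝒴) × Ξ :=
    fun p => (Fin.snoc (α := fun _ => 𝒜 × 𝒴) p.1.1 (π t p.1, p.2), p.1.2)
  let ψ : (Fin (t + 1) → 𝒜 × 𝒴) × Ξ → ((Fin t → 𝒜 × 𝒴) × Ξ) × 𝒴 :=
    fun p => ((fun i => p.1 i.castSucc, p.2), (p.1 (Fin.last t)).2)
  have hφ : Measurable φ := by
    refine Measurable.prodMk (measurable_pi_lambda _ fun i => ?_) (by fun_prop)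
    refine Fin.lastCases ?_ (fun j => ?_) i
    · simp only [Fin.snoc_last]
      exact ((hπ t).comp measurable_fst).prodMk measurable_snd
    · simp only [Fin.snoc_castSucc]
      fun_prop
  have hψ : Measurable ψ := by fun_prop
  have h := condEntropy_comp_of_leftInverse (P := P) hAb hW hφ hψ fun p => by simp [φ, ψ]
  rw [← h]
  congr 1
  funext ω
  refine Prod.ext (funext fun i => ?_) rfl
  refine Fin.lastCases ?_ (fun j => ?_) i
  · simp [φ, history, ← hAπ]
  · simp [φ, history]

variable [StandardBorelSpace 𝒴] [Nonempty 𝒴] [StandardBorelSpace Ξ] [Nonempty Ξ]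

theorem condEntropy_history_eq_add (hA : M.IsPolicyDriven A) (hAb : Measurable Ab) {t : ℕ}
    (hH : condEntropy Ab (fun ω => (M.history A t ω, M.ξ ω)) P ≠ ∞) :
    AEMeasurable (M.infoGain A Ab t) P ∧
      condEntropy Ab (fun ω => (M.history A t ω, M.ξ ω)) P =
        ∫⁻ ω, M.infoGain A Ab t ω ∂P +
          condEntropy Ab (fun ω => (M.history A (t + 1) ω, M.ξ ω)) P := by
  rw [condEntropy_history_succ hA hAb]
  exact condEntropy_eq_lintegral_condMutualInfo_add
    (measurable_history fun i _ => hA.measurable_action i) M.measurable_ξ hAb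
    (measurable_obs (hA.measurable_action t)) hH

/-- Chain rule along the history. -/
theorem condEntropy_eq_sum_infoGain_add (hA : M.IsPolicyDriven A) (hAb : Measurable Ab)
    (hH : condEntropy Ab M.ξ P ≠ ∞) (n : ℕ) :
    condEntropy Ab M.ξ P = ∑ t ∈ Finset.range n, ∫⁻ ω, M.infoGain A Ab t ω ∂P +
      condEntropy Ab (fun ω => (M.history A n ω, M.ξ ω)) P := by
  induction n with
  | zero => simp [condEntropy_history_zero hAb]
  | succ n ih =>
    -- By the induction hypothesis the remaining entropy is at most the initial one, so the one-step
    -- rule applies.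
    have hn : condEntropy Ab (fun ω => (M.history A n ω, M.ξ ω)) P ≠ ∞ :=
      ne_top_of_le_ne_top hH (ih ▸ le_add_self)
    rw [Finset.sum_range_succ, add_assoc, ← (condEntropy_history_eq_add hA hAb hn).2, ← ih]

theorem aemeasurable_infoGain (hA : M.IsPolicyDriven A) (hAb : Measurable Ab)
    (hH : condEntropy Ab M.ξ P ≠ ∞) (t : ℕ) : AEMeasurable (M.infoGain A Ab t) P :=
  (condEntropy_history_eq_add hA hAb (ne_top_of_le_ne_top hH
    ((condEntropy_eq_sum_infoGain_add hA hAb hH t).symm ▸ le_add_self))).1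

/-- The total expected information gain is at most the entropy of the benchmark action. -/
theorem tsum_lintegral_infoGain_le (hA : M.IsPolicyDriven A) (hAb : Measurable Ab)
    (hH : condEntropy Ab M.ξ P ≠ ∞) :
    ∑' t, ∫⁻ ω, M.infoGain A Ab t ω ∂P ≤ condEntropy Ab M.ξ P := by
  rw [ENNReal.tsum_eq_iSup_nat]
  exact iSup_le fun n => (condEntropy_eq_sum_infoGain_add hA hAb hH n).symm ▸ le_self_add

/-- The discounted expected absolute shortfall is controlled by the information ratio and the
entropy. -/
theorem tsum_mul_lintegral_shortfall_le (hA : M.IsPolicyDriven A) (hAb : Measurable Ab)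
    (hH : condEntropy Ab M.ξ P ≠ ∞) {α : ℝ} (hα0 : 0 ≤ α) (hα1 : α < 1)
    (hΓ : M.infoRatio α A Ab ≠ ∞) :
    ∑' t : ℕ, ENNReal.ofReal (α ^ t) * ∫⁻ ω, ENNReal.ofReal |M.shortfall A Ab t ω| ∂P ≤
      (M.infoRatio α A Ab * condEntropy Ab M.ξ P / ENNReal.ofReal (1 - α ^ 2)) ^ (1 / 2 : ℝ) := by
  have hpos : 0 < 1 - α ^ 2 := by nlinarith
  have hne : ENNReal.ofReal (1 - α ^ 2) ≠ 0 := (ENNReal.ofReal_pos.2 hpos).ne'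
  have hS : M.infoRatio α A Ab = ENNReal.ofReal (1 - α ^ 2) *
      ∑' t : ℕ, ENNReal.ofReal (α ^ t) ^ 2 *
        ∫⁻ ω, ENNReal.ofReal |M.shortfall A Ab t ω| ^ 2 / M.infoGain A Ab t ω ∂P := by
    simp only [infoRatio, ← ENNReal.ofReal_pow (abs_nonneg _), sq_abs,
      ← ENNReal.ofReal_pow (pow_nonneg hα0 _), ← pow_mul, mul_comm _ 2]
  have hStop : ∑' t : ℕ, ENNReal.ofReal (α ^ t) ^ 2 *
      ∫⁻ ω, ENNReal.ofReal |M.shortfall A Ab t ω| ^ 2 / M.infoGain A Ab t ω ∂P ≠ ∞ := by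
    intro h
    rw [hS, h, ENNReal.mul_top hne] at hΓ
    exact hΓ rfl
  have hle := tsum_lintegral_infoGain_le hA hAb hH
  have hms : ∀ t, AEMeasurable (fun ω => ENNReal.ofReal |M.shortfall A Ab t ω|) P := fun t =>
    ((stronglyMeasurable_condExp.mono (measurable_history
      fun i _ => hA.measurable_action i).comap_le).measurable.abs.ennreal_ofReal).aemeasurable
  refine (tsum_mul_lintegral_le_sqrt hms (aemeasurable_infoGain hA hAb hH) hStop
    (ne_top_of_le_ne_top hH hle)).trans ?_
  rw [hS, mul_assoc, ENNReal.mul_div_right_comm, ENNReal.div_self hne ENNReal.ofReal_ne_top,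
    one_mul, ENNReal.mul_rpow_of_nonneg _ _ (by norm_num : (0 : ℝ) ≤ 1 / 2)]
  gcongr

end Information

end BanditModel

/-! ### Discounted sums and the conclusion -/

/-- The expected discounted series of `U - V t`, compared with a reference variable `B`. -/
theorem integral_tsum_discounted_sub {Ω : Type*} [MeasurableSpace Ω] {P : Measure Ω}
    {α : ℝ} (hα0 : 0 ≤ α) (hα1 : α < 1) {U B : Ω → ℝ} {V : ℕ → Ω → ℝ} (hU : Integrable U P)
    (hB : Integrable B P) (hV : ∀ t, Integrable (V t) P)
    (hsum : Summable fun t : ℕ => α ^ t * ∫ ω, |V t ω| ∂P) :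
    (Summable fun t : ℕ => α ^ t * ∫ ω, (B ω - V t ω) ∂P) ∧
    ∫ ω, ∑' t : ℕ, α ^ t * (U ω - V t ω) ∂P =
      (∫ ω, (U ω - B ω) ∂P) / (1 - α) + ∑' t : ℕ, α ^ t * ∫ ω, (B ω - V t ω) ∂P := by
  have hgeo := summable_geometric_of_lt_one hα0 hα1
  have habs : ∀ X : Ω → ℝ, Integrable X P →
      Summable fun t : ℕ => α ^ t * ∫ ω, |X ω - V t ω| ∂P := by
    intro X hX
    refine Summable.of_nonneg_of_le (fun t => by positivity) (fun t => ?_)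
      ((hgeo.mul_right (∫ ω, |X ω| ∂P)).add hsum)
    rw [← mul_add, ← integral_add hX.abs (hV t).abs]
    refine mul_le_mul_of_nonneg_left ?_ (pow_nonneg hα0 t)
    exact integral_mono (hX.sub (hV t)).abs (hX.abs.add (hV t).abs) fun ω => abs_sub (X ω) (V t ω)
  have hBs : Summable fun t : ℕ => α ^ t * ∫ ω, (B ω - V t ω) ∂P := by
    refine Summable.of_norm_bounded (habs B hB) fun t => ?_
    rw [norm_mul, Real.norm_of_nonneg (pow_nonneg hα0 t)]
    gcongr
    exact norm_integral_le_integral_norm _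
  refine ⟨hBs, ?_⟩
  rw [← integral_tsum_of_summable_integral_norm (F := fun t ω => α ^ t * (U ω - V t ω))
    (fun t => (hU.sub (hV t)).const_mul _)]
  -- Expand `1 / (1 - α)` as `∑ α^t` and match termwise through `U - V t = (U - B) + (B - V t)`.
  · rw [div_eq_mul_inv, mul_comm, ← tsum_geometric_of_lt_one hα0 hα1, ← tsum_mul_right,
      ← (hgeo.mul_right _).tsum_add hBs]
    refine tsum_congr fun t => ?_
    rw [integral_const_mul, integral_sub hU (hV t), integral_sub hU hB, integral_sub hB (hV t)]
    ring
  · refine (habs U hU).congr fun t => ?_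
    rw [← integral_const_mul]
    congr 1
    funext ω
    simp [abs_of_nonneg hα0]

/-- Each term is at most its positive part, and the positive parts are summable by absolute
convergence. -/
theorem ENNReal.ofReal_tsum_le {ι : Type*} {f : ι → ℝ} (hf : Summable f) :
    ENNReal.ofReal (∑' i, f i) ≤ ∑' i, ENNReal.ofReal (f i) := by
  have hpos : Summable fun i => max (f i) 0 :=
    Summable.of_nonneg_of_le (fun i => le_max_right _ _)
      (fun i => max_le (le_abs_self _) (abs_nonneg _)) hf.abs
  refine (ENNReal.ofReal_le_ofReal (hf.tsum_le_tsum (fun i => le_max_left (f i) 0) hpos)).trans ?_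
  rw [ENNReal.ofReal_tsum_of_nonneg (fun i => le_max_right _ _) hpos]
  simp

/-- The left side is a real number while the square root may be infinite, so the comparison takes
place in `EReal`. -/
theorem mainTheorem1 {Ω Θ Ξ 𝒜 𝒴 : Type*} [MeasurableSpace Ω] [MeasurableSpace Θ]
    [MeasurableSpace Ξ] [StandardBorelSpace Ξ] [Nonempty Ξ]
    [MeasurableSpace 𝒜] [StandardBorelSpace 𝒜] [Nonempty 𝒜]
    [MeasurableSpace 𝒴] [StandardBorelSpace 𝒴] [Nonempty 𝒴]
    (P : Measure Ω) [IsProbabilityMeasure P] (M : BanditModel Ω Θ Ξ 𝒜 𝒴 P)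
    (α : ℝ) (hα0 : 0 ≤ α) (hα1 : α < 1)
    (A : ℕ → Ω → 𝒜) (hA : M.IsPolicyDriven A)
    (Ab : Ω → 𝒜) (hAb : Measurable Ab)
    -- the optimal reward is well defined and integrable
    (hmean : ∀ᵐ ω ∂P, ∀ a, Integrable (fun y : 𝒜 → 𝒴 => M.R (y a)) (M.κ (M.θ ω)))
    (hbdd : ∀ᵐ ω ∂P, BddAbove (Set.range fun a => M.meanReward (M.θ ω) a))
    (hopt : Integrable M.optReward P)
    -- the rewards are integrable and the discounted series converges absolutely in `L¹`
    (hbench : Integrable (M.benchReward Ab) P)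
    (hrew : ∀ t, Integrable (M.reward A t) P)
    (hsum : Summable fun t : ℕ => α ^ t * ∫ ω, |M.reward A t ω| ∂P)
    -- the product `Γ · H` is not of the undefined form `0 · ∞`
    (hprod : ¬ (M.infoRatio α A Ab = 0 ∧ condEntropy Ab M.ξ P = ∞) ∧
      ¬ (M.infoRatio α A Ab = ∞ ∧ condEntropy Ab M.ξ P = 0)) :
    ((∫ ω, ∑' t : ℕ, α ^ t * (M.optReward ω - M.reward A t ω) ∂P : ℝ) : EReal) ≤
      (((∫ ω, (M.optReward ω - M.benchReward Ab ω) ∂P) / (1 - α) : ℝ) : EReal) +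
        (((M.infoRatio α A Ab * condEntropy Ab M.ξ P / ENNReal.ofReal (1 - α ^ 2)) ^ (1 / 2 : ℝ) :
          ℝ≥0∞) : EReal) := by
  obtain ⟨hsd, heq⟩ := integral_tsum_discounted_sub hα0 hα1 hopt hbench hrew hsum
  rw [heq, EReal.coe_add]
  refine add_le_add le_rfl ?_
  have hfin : ENNReal.ofReal (1 - α ^ 2) ≠ ∞ := ENNReal.ofReal_ne_top
  -- If `H` or `Γ` is infinite, `hprod` makes the other factor nonzero, so the bound is `∞`.
  by_cases hH : condEntropy Ab M.ξ P = ∞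
  · rw [hH, ENNReal.mul_top fun h => hprod.1 ⟨h, hH⟩, ENNReal.top_div_of_ne_top hfin,
      ENNReal.top_rpow_of_pos (by norm_num)]
    exact le_top
  by_cases hΓ : M.infoRatio α A Ab = ∞
  · rw [hΓ, ENNReal.top_mul fun h => hprod.2 ⟨hΓ, h⟩, ENNReal.top_div_of_ne_top hfin,
      ENNReal.top_rpow_of_pos (by norm_num)]
    exact le_top
  have hle := BanditModel.tsum_mul_lintegral_shortfall_le hA hAb hH hα0 hα1 hΓ
  -- Tower property: the conditional expectation given the history has the same mean.
  have hshort : ∀ t, ∫ ω, (M.benchReward Ab ω - M.reward A t ω) ∂P =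
      ∫ ω, M.shortfall A Ab t ω ∂P := fun t => (integral_condExp
    (BanditModel.measurable_history fun i _ => hA.measurable_action i).comap_le).symm
  have hterm : ∀ t, ENNReal.ofReal (α ^ t * ∫ ω, (M.benchReward Ab ω - M.reward A t ω) ∂P) ≤
      ENNReal.ofReal (α ^ t) * ∫⁻ ω, ENNReal.ofReal |M.shortfall A Ab t ω| ∂P := by
    intro t
    have hint : Integrable (M.shortfall A Ab t) P := integrable_condExp
    rw [hshort, ENNReal.ofReal_mul (pow_nonneg hα0 t),
      ← ofReal_integral_eq_lintegral_ofReal hint.abs (ae_of_all _ fun _ => abs_nonneg _)]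
    refine mul_le_mul_right (ENNReal.ofReal_le_ofReal (integral_mono ?_ ?_ ?_)) _
    exacts [hint, hint.abs, fun ω => le_abs_self _]
  have hreal : ENNReal.ofReal
      (∑' t : ℕ, α ^ t * ∫ ω, (M.benchReward Ab ω - M.reward A t ω) ∂P) ≤
      ∑' t : ℕ, ENNReal.ofReal (α ^ t) * ∫⁻ ω, ENNReal.ofReal |M.shortfall A Ab t ω| ∂P :=
    (ENNReal.ofReal_tsum_le hsd).trans (ENNReal.tsum_le_tsum hterm)
  refine le_trans ?_ (EReal.coe_ennreal_le_coe_ennreal_iff.2 (hreal.trans hle))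
  -- The sum may be negative; `ENNReal.ofReal` replaces it by its maximum with `0`, which only
  -- increases it.
  rw [EReal.coe_ennreal_ofReal]
  exact_mod_cast le_max_left _ _
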